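/- Let $A\in\mathbb{R}^{n\times n}$, $B\in\mathbb{R}^{n\times m}$, $0\le T_{min}\le T_{max}$ and $T_{max}>0$. Consider the system $\dot x(t)=Ax(t)+Bu(t)$ with the sampled-data control law $$u(t)=K_1x(t_k)+K_2u(t_{k-1}),\quad t\in[t_k,t_{k+1}),\ k\ge 0,$$ where $K_1\in\mathbb{R}^{m\times n}$, $K_2\in\mathbb{R}^{m\times m}$, the initial data $x(t_0)\in\mathbb{R}^n$ and $u(t_{-1})\in\mathbb{R}^m$ are arbitrary, and the sequence $(t_k)_{k\ge0}$ of sampling instants is strictly increasing and unbounded with $T_k:=t_{k+1}-t_k\in[T_{min},T_{max}]$ for all $k$. The control law is said to quadratically stabilize the system for all such sampling sequences if there are a symmetric matrix $P\succ0$ and a number $\alpha>0$ such that, for every such sequence, every closed-loop trajectory and every $k\ge0$, the vectors $\xi_k:=(x(t_k),u(t_{k-1}))\in\mathbb{R}^{n+m}$ satisfy $\xi_{k+1}^TP\xi_{k+1}-\xi_k^TP\xi_k\le-\alpha|\xi_k|^2$. Put $$\bar A=\begin{bmatrix}A&B\\0&0\end{bmatrix},\quad J_0=\begin{bmatrix}I&0\\0&0\end{bmatrix},\quad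 B_0=\begin{bmatrix}0\\I\end{bmatrix}.$$ The following statements are equivalent: (a) There exist gains $K_1,K_2$ whose control law quadratically stabilizes the system for all sampling sequences with $T_k\in[T_{min},T_{max}]$. (b) There exist a differentiable function $S$ from $[0,T_{max}]$ to the symmetric $(n+m)\times(n+m)$ real matrices with $S(0)\succ0$, a matrix $Y\in\mathbb{R}^{m\times(n+m)}$ and a scalar $\varepsilon>0$ such that $$\bar AS(\tau)+S(\tau)\bar A^T+\dot S(\tau)\preceq0\quad\text{for all }\tau\in[0,T_{max}]$$ and $$\begin{bmatrix}-S(\theta)+\varepsilon I& J_0S(0)+B_0Y\\ (J_0S(0)+B_0Y)^T&-S(0)\end{bmatrix}\preceq0\quad\text{for all }\theta\in[T_{min},T_{max}].$$ Moreover, whenever $(S,Y,\varepsilon)$ is as in (b), the control law with gains given by $[K_1\ K_2]=K:=YS(0)^{-1}$ quadratically stabilizes the system for all sampling sequences with $T_k\in[T_{min},T_{max}]$. -/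

import Mathlib

open Set Filter

/-- The matrix inequality `M ⪯ 0`: `M` is symmetric and negative semidefinite. -/
def NegSemidef {ι : Type*} (M : Matrix ι ι ℝ) : Prop :=
  (-M).PosSemidef

/-- The input value in force just before the `k`-th sampling instant: `u (t (k - 1))` for
`k ≥ 1`, and the initially held value `u₀` (the value "`u(t_{-1})`") for `k = 0`. -/
def prevInput {m : ℕ} (t : ℕ → ℝ) (u₀ : Fin m → ℝ) (u : ℝ → Fin m → ℝ) : ℕ → Fin m → ℝ
  | 0 => u₀
  | k + 1 => u (t k)

/-- Sampling instants: strictly increasing and unbounded, with all inter-sampling times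
`t (k + 1) - t k` in `[Tmin, Tmax]`. -/
structure IsSamplingSequence (Tmin Tmax : ℝ) (t : ℕ → ℝ) : Prop where
  strictMono : StrictMono t
  tendsto_atTop : Tendsto t atTop atTop
  dwell : ∀ k, t (k + 1) - t k ∈ Icc Tmin Tmax

/-- `(x, u)`, with initially held input `u₀`, is a trajectory of `x' = A x + B u` under the
sampled-data control law `u(s) = K₁ x(t_k) + K₂ u(t_{k-1})` for `s ∈ [t_k, t_{k+1})`. -/
structure IsSampledDataTrajectory {n m : ℕ} (A : Matrix (Fin n) (Fin n) ℝ)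
    (B : Matrix (Fin n) (Fin m) ℝ) (K₁ : Matrix (Fin m) (Fin n) ℝ)
    (K₂ : Matrix (Fin m) (Fin m) ℝ) (t : ℕ → ℝ) (u₀ : Fin m → ℝ)
    (x : ℝ → Fin n → ℝ) (u : ℝ → Fin m → ℝ) : Prop where
  continuousOn : ContinuousOn x (Ici (t 0))
  hasDerivAt : ∀ k, ∀ s ∈ Ioo (t k) (t (k + 1)),
    HasDerivAt x (A.mulVec (x s) + B.mulVec (u s)) s
  control : ∀ k, ∀ s ∈ Ico (t k) (t (k + 1)),
    u s = K₁.mulVec (x (t k)) + K₂.mulVec (prevInput t u₀ u k)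

/-- The state of the closed-loop system just before the `k`-th sampling instant, namely
`(x(t_k), u(t_{k-1}))`. -/
def sampledState {n m : ℕ} (t : ℕ → ℝ) (u₀ : Fin m → ℝ) (x : ℝ → Fin n → ℝ)
    (u : ℝ → Fin m → ℝ) (k : ℕ) : Fin n ⊕ Fin m → ℝ :=
  Sum.elim (x (t k)) (prevInput t u₀ u k)

/-- The control law with gains `K₁`, `K₂` quadratically stabilizes `x' = A x + B u` for all
sampling sequences with inter-sampling times in `[Tmin, Tmax]`: one positive definite quadratic
form `V(ξ) = ξᵀ P ξ` is a strict discrete-time Lyapunov function, with a uniform decrease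
`V(ξ_{k+1}) - V(ξ_k) ≤ -α |ξ_k|²`, `ξ_k = (x(t_k), u(t_{k-1}))`, along all closed-loop
trajectories. -/
def QuadraticallyStabilizes {n m : ℕ} (A : Matrix (Fin n) (Fin n) ℝ)
    (B : Matrix (Fin n) (Fin m) ℝ) (K₁ : Matrix (Fin m) (Fin n) ℝ)
    (K₂ : Matrix (Fin m) (Fin m) ℝ) (Tmin Tmax : ℝ) : Prop :=
  ∃ P : Matrix (Fin n ⊕ Fin m) (Fin n ⊕ Fin m) ℝ, P.PosDef ∧ ∃ α : ℝ, 0 < α ∧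
    ∀ (t : ℕ → ℝ) (u₀ : Fin m → ℝ) (x : ℝ → Fin n → ℝ) (u : ℝ → Fin m → ℝ),
      IsSamplingSequence Tmin Tmax t → IsSampledDataTrajectory A B K₁ K₂ t u₀ x u →
      ∀ k, dotProduct (sampledState t u₀ x u (k + 1)) (P.mulVec (sampledState t u₀ x u (k + 1)))
          - dotProduct (sampledState t u₀ x u k) (P.mulVec (sampledState t u₀ x u k))
        ≤ -α * dotProduct (sampledState t u₀ x u k) (sampledState t u₀ x u k)

/-- The lifted matrix `[A B; 0 0]`. -/
def liftedA {n m : ℕ} (A : Matrix (Fin n) (Fin n) ℝ) (B : Matrix (Fin n) (Fin m) ℝ) :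
    Matrix (Fin n ⊕ Fin m) (Fin n ⊕ Fin m) ℝ :=
  Matrix.fromBlocks A B 0 0

/-- The matrix `J₀ = [I 0; 0 0]`. -/
def matJ₀ (n m : ℕ) : Matrix (Fin n ⊕ Fin m) (Fin n ⊕ Fin m) ℝ :=
  Matrix.fromBlocks 1 0 0 0

/-- The matrix `B₀ = [0; I]`. -/
def matB₀ (n m : ℕ) : Matrix (Fin n ⊕ Fin m) (Fin m) ℝ :=
  Matrix.fromRows 0 1

/-- Entrywise derivative at `τ` of a matrix function on `[0, T]` (one-sided at the ends). -/
noncomputable def matrixDerivOn {ι : Type*} (T : ℝ) (S : ℝ → Matrix ι ι ℝ) (τ : ℝ) :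
    Matrix ι ι ℝ :=
  Matrix.of fun i j => derivWithin (fun s => S s i j) (Icc 0 T) τ

/-- `(S, Y, ε)` is a feasible point of the matrix-inequality problem; only the values of `S` on
`[0, Tmax]` matter. -/
structure IsFeasible {n m : ℕ} (A : Matrix (Fin n) (Fin n) ℝ) (B : Matrix (Fin n) (Fin m) ℝ)
    (Tmin Tmax : ℝ) (S : ℝ → Matrix (Fin n ⊕ Fin m) (Fin n ⊕ Fin m) ℝ)
    (Y : Matrix (Fin m) (Fin n ⊕ Fin m) ℝ) (ε : ℝ) : Prop where
  symm : ∀ τ ∈ Icc 0 Tmax, (S τ).IsSymm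
  differentiable : ∀ i j, DifferentiableOn ℝ (fun τ => S τ i j) (Icc 0 Tmax)
  posDef_zero : (S 0).PosDef
  eps_pos : 0 < ε
  differential : ∀ τ ∈ Icc 0 Tmax,
    NegSemidef (liftedA A B * S τ + S τ * (liftedA A B).transpose + matrixDerivOn Tmax S τ)
  block : ∀ θ ∈ Icc Tmin Tmax,
    NegSemidef (Matrix.fromBlocks
      (-S θ + ε • (1 : Matrix (Fin n ⊕ Fin m) (Fin n ⊕ Fin m) ℝ))
      (matJ₀ n m * S 0 + matB₀ n m * Y)
      (matJ₀ n m * S 0 + matB₀ n m * Y).transpose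
      (-S 0))

/-! Between samples the input is frozen, so with `F = liftedA A B` and `M = jumpMatrix K₁ K₂` the
sampled states obey `ξ_{k+1} = exp (T_k F) M ξ_k` (`sampledState_succ`). Quadratic stabilization
thus means that one `P` decreases under `exp (θ F) M` for every admissible `θ`
(`quadraticallyStabilizes_iff`). Put `Q = P⁻¹`. By Schur complements the decrease amounts to `exp (θ
F) M Q Mᵀ exp (θ Fᵀ) ≺ Q`, that is `M Q Mᵀ ≺ exp (-θ F) Q exp (-θ Fᵀ)`. The right side solves the
Lyapunov equation in `θ` with value `Q` at `0`; it serves as `S`, and `Y = K Q` makes the block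
condition linear. Conversely, the differential inequality makes `exp (τ F) S(τ) exp (τ Fᵀ)`
nonincreasing (`IsFeasible.antitoneOn_quadratic`), so the block condition at `θ` transports back to
a decrease of `S(0)⁻¹`. Compactness of `[Tmin, Tmax]` makes the margins `α` and `ε` interchangeable,
through a contraction factor `1 - δ`. -/

open scoped Matrix

/-! ### Matrix exponentials and entrywise calculus. -/

section MatrixCalculus

variable {ι κ l : Type*} [Fintype ι]

open scoped Matrix.Norms.Operator in
theorem hasDerivAt_exp_smul_entry [DecidableEq ι] (F : Matrix ι ι ℝ) (s : ℝ) (i j : ι) :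
    HasDerivAt (fun r : ℝ => NormedSpace.exp (r • F) i j) ((F * NormedSpace.exp (s • F)) i j) s := by
  have h := hasDerivAt_exp_smul_const' (𝕂 := ℝ) F s
  exact hasDerivAt_pi.1 (hasDerivAt_pi.1 h i) j

theorem exp_smul_commute [DecidableEq ι] (F : Matrix ι ι ℝ) (s : ℝ) :
    Commute F (NormedSpace.exp (s • F)) :=
  ((Commute.refl F).smul_right s).exp_right

theorem exp_smul_mul_exp_neg_smul [DecidableEq ι] (F : Matrix ι ι ℝ) (s : ℝ) :
    NormedSpace.exp (s • F) * NormedSpace.exp (-s • F) = 1 := by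
  rw [← Matrix.exp_add_of_commute _ _ (((Commute.refl F).smul_right _).smul_left _), ← add_smul]
  simp

theorem exp_neg_smul_mul_exp_smul [DecidableEq ι] (F : Matrix ι ι ℝ) (s : ℝ) :
    NormedSpace.exp (-s • F) * NormedSpace.exp (s • F) = 1 := by
  simpa using exp_smul_mul_exp_neg_smul F (-s)

theorem exp_smul_transpose [DecidableEq ι] (F : Matrix ι ι ℝ) (s : ℝ) :
    (NormedSpace.exp (s • F))ᵀ = NormedSpace.exp (s • Fᵀ) := by
  rw [← Matrix.exp_transpose, Matrix.transpose_smul]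

theorem hasDerivWithinAt_mul_entry {X : ℝ → Matrix l ι ℝ} {Y : ℝ → Matrix ι κ ℝ}
    {X' : Matrix l ι ℝ} {Y' : Matrix ι κ ℝ} {t : Set ℝ} {s : ℝ}
    (hX : ∀ i j, HasDerivWithinAt (fun r => X r i j) (X' i j) t s)
    (hY : ∀ i j, HasDerivWithinAt (fun r => Y r i j) (Y' i j) t s) (i : l) (j : κ) :
    HasDerivWithinAt (fun r => (X r * Y r) i j) ((X' * Y s + X s * Y') i j) t s := by
  simp only [Matrix.mul_apply, Matrix.add_apply, ← Finset.sum_add_distrib]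
  exact HasDerivWithinAt.fun_sum fun k _ => (hX i k).mul (hY k j)

theorem hasDerivWithinAt_mulVec {X : ℝ → Matrix l ι ℝ} {y : ℝ → ι → ℝ}
    {X' : Matrix l ι ℝ} {y' : ι → ℝ} {t : Set ℝ} {s : ℝ}
    (hX : ∀ i j, HasDerivWithinAt (fun r => X r i j) (X' i j) t s)
    (hy : ∀ i, HasDerivWithinAt (fun r => y r i) (y' i) t s) (i : l) :
    HasDerivWithinAt (fun r => (X r *ᵥ y r) i) ((X' *ᵥ y s + X s *ᵥ y') i) t s := by
  simp only [Matrix.mulVec, dotProduct, Pi.add_apply, ← Finset.sum_add_distrib]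
  exact HasDerivWithinAt.fun_sum fun k _ => (hX i k).mul (hy k)

theorem hasDerivWithinAt_dotProduct {x y : ℝ → ι → ℝ} {x' y' : ι → ℝ} {t : Set ℝ} {s : ℝ}
    (hx : ∀ i, HasDerivWithinAt (fun r => x r i) (x' i) t s)
    (hy : ∀ i, HasDerivWithinAt (fun r => y r i) (y' i) t s) :
    HasDerivWithinAt (fun r => x r ⬝ᵥ y r) (x' ⬝ᵥ y s + x s ⬝ᵥ y') t s := by
  simp only [dotProduct, ← Finset.sum_add_distrib]
  exact HasDerivWithinAt.fun_sum fun k _ => (hx k).mul (hy k)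

theorem hasDerivAt_exp_smul_mulVec [DecidableEq ι] (F : Matrix ι ι ℝ) (v : ι → ℝ) (s : ℝ) :
    HasDerivAt (fun r : ℝ => NormedSpace.exp (r • F) *ᵥ v)
      (F *ᵥ (NormedSpace.exp (s • F) *ᵥ v)) s := by
  rw [hasDerivAt_pi]
  intro i
  rw [← hasDerivWithinAt_univ]
  have := hasDerivWithinAt_mulVec (X := fun r : ℝ => NormedSpace.exp (r • F)) (y := fun _ => v)
    (y' := 0) (t := univ) (s := s)
    (fun i j => (hasDerivAt_exp_smul_entry F s i j).hasDerivWithinAt)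
    (fun i => hasDerivWithinAt_const _ _ _) i
  simpa [Matrix.mulVec_mulVec] using this

/-- The variation-of-constants principle for `y' = F y` on a closed interval. -/
theorem eq_exp_smul_mulVec_of_hasDerivAt [DecidableEq ι] (F : Matrix ι ι ℝ) {a b : ℝ} (hab : a < b)
    {y : ℝ → ι → ℝ} (hc : ContinuousOn y (Icc a b))
    (hd : ∀ s ∈ Ioo a b, HasDerivAt y (F *ᵥ y s) s) :
    y b = NormedSpace.exp ((b - a) • F) *ᵥ y a := by
  have hE : ∀ (s : ℝ) (i j : ι), HasDerivAt
      (fun r : ℝ => NormedSpace.exp ((r - a) • (-F)) i j)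
      ((-F * NormedSpace.exp ((s - a) • (-F))) i j) s := fun s i j => by
    have h := (hasDerivAt_exp_smul_entry (-F) (s - a) i j).comp s ((hasDerivAt_id s).sub_const a)
    rwa [mul_one] at h
  have hcomm : ∀ s : ℝ, F * NormedSpace.exp ((s - a) • (-F))
      = NormedSpace.exp ((s - a) • (-F)) * F := fun s => by
    simpa using (exp_smul_commute (-F) (s - a)).neg_left.eq
  -- Undoing the flow leaves a function with zero derivative; the mean value theorem is applied to
  -- each real coordinate.
  have key : ∀ i, (NormedSpace.exp ((b - a) • (-F)) *ᵥ y b) i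
      = (NormedSpace.exp ((a - a) • (-F)) *ᵥ y a) i := by
    intro i
    obtain ⟨c, -, hc'⟩ := exists_hasDerivAt_eq_slope
      (fun r => (NormedSpace.exp ((r - a) • (-F)) *ᵥ y r) i) (fun _ => 0) hab
      (by
        simp only [Matrix.mulVec, dotProduct]
        refine continuousOn_finsetSum _ fun j _ => ContinuousOn.mul ?_ ?_
        · exact fun s _ => (hE s i j).continuousAt.continuousWithinAt
        · exact (continuous_apply j).comp_continuousOn hc)
      (by
        intro s hs
        have := hasDerivWithinAt_mulVec (t := univ) (fun i j => (hE s i j).hasDerivWithinAt)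
          (fun i => ((hasDerivAt_pi.1 (hd s hs)) i).hasDerivWithinAt) i
        rw [hasDerivWithinAt_univ, Matrix.mulVec_mulVec, ← Matrix.add_mulVec, Matrix.neg_mul,
          hcomm, neg_add_cancel, Matrix.zero_mulVec] at this
        exact this)
    rw [eq_div_iff (sub_pos.2 hab).ne', zero_mul] at hc'
    linarith
  have h1 : NormedSpace.exp ((b - a) • (-F)) *ᵥ y b = y a := by
    funext i
    simpa using key i
  rw [← h1, Matrix.mulVec_mulVec, smul_neg, ← neg_smul, exp_smul_mul_exp_neg_smul,
    Matrix.one_mulVec]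

theorem mulVec_dotProduct_self_le (X : Matrix l ι ℝ) [Fintype l] (v : ι → ℝ) :
    (X *ᵥ v) ⬝ᵥ (X *ᵥ v) ≤ (∑ i, ∑ j, X i j ^ 2) * (v ⬝ᵥ v) := by
  have : v ⬝ᵥ v = ∑ j, v j ^ 2 := by simp [dotProduct, sq]
  rw [this, Finset.sum_mul, dotProduct]
  refine Finset.sum_le_sum fun i _ => ?_
  rw [← sq]
  exact Finset.sum_mul_sq_le_sq_mul_sq _ _ _

/-- On a compact interval, `exp (s F)` is uniformly bounded in the Euclidean operator norm. -/
theorem exists_exp_smul_mulVec_le [DecidableEq ι] (F : Matrix ι ι ℝ) (a b : ℝ) :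
    ∃ C : ℝ, 0 < C ∧ ∀ s ∈ Icc a b, ∀ v : ι → ℝ,
      (NormedSpace.exp (s • F) *ᵥ v) ⬝ᵥ (NormedSpace.exp (s • F) *ᵥ v) ≤ C * (v ⬝ᵥ v) := by
  have hcont : Continuous fun s : ℝ => ∑ i, ∑ j, NormedSpace.exp (s • F) i j ^ 2 :=
    continuous_finsetSum _ fun i _ => continuous_finsetSum _ fun j _ =>
      (continuous_iff_continuousAt.2 fun s => (hasDerivAt_exp_smul_entry F s i j).continuousAt).pow 2
  obtain ⟨C, hC⟩ := (isCompact_Icc (a := a) (b := b)).bddAbove_image hcont.continuousOn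
  refine ⟨max C 1, by positivity, fun s hs v => (mulVec_dotProduct_self_le _ v).trans ?_⟩
  have := hC (mem_image_of_mem _ hs)
  gcongr
  · exact Finset.sum_nonneg fun i _ => mul_self_nonneg (v i)
  · exact this.trans (le_max_left _ _)

end MatrixCalculus

/-! ### Bounds for quadratic forms and Schur complements. -/

section QuadraticForms

variable {ι κ : Type*} [Fintype ι] [Fintype κ]

theorem dotProduct_self_nonneg_real (v : ι → ℝ) : 0 ≤ v ⬝ᵥ v :=
  Finset.sum_nonneg fun i _ => mul_self_nonneg (v i)

theorem Matrix.IsSymm.dotProduct_mulVec_comm {P : Matrix ι ι ℝ} (hP : P.IsSymm) (v w : ι → ℝ) :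
    v ⬝ᵥ P *ᵥ w = w ⬝ᵥ P *ᵥ v := by
  rw [Matrix.dotProduct_mulVec, dotProduct_comm, ← Matrix.mulVec_transpose, hP.eq]

theorem Matrix.PosDef.isSymm {ι : Type*} {P : Matrix ι ι ℝ} (hP : P.PosDef) : P.IsSymm := by
  simpa using hP.isHermitian

theorem Matrix.PosDef.quadratic_nonneg {P : Matrix ι ι ℝ} (hP : P.PosDef) (v : ι → ℝ) :
    0 ≤ v ⬝ᵥ P *ᵥ v := by
  simpa using hP.posSemidef.dotProduct_mulVec_nonneg v

theorem exists_quadratic_le (P : Matrix ι ι ℝ) :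
    ∃ C : ℝ, 0 < C ∧ ∀ v : ι → ℝ, v ⬝ᵥ P *ᵥ v ≤ C * (v ⬝ᵥ v) := by
  -- From `2 v·Pv ≤ |v|² + |Pv|²` and the Frobenius bound on `|Pv|²`.
  refine ⟨(1 + ∑ i, ∑ j, P i j ^ 2) / 2, by positivity, fun v => ?_⟩
  have h1 := mulVec_dotProduct_self_le P v
  have h2 := dotProduct_self_nonneg_real (v - P *ᵥ v)
  simp only [sub_dotProduct, dotProduct_sub] at h2
  rw [dotProduct_comm (P *ᵥ v) v] at h2
  linarith

/-- If `P⁻¹ ≤ C` then `P ≥ C⁻¹`: expand the form at `v - C⁻¹ P⁻¹ v`. No eigenvalues are needed. -/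
theorem Matrix.PosDef.exists_le_quadratic [DecidableEq ι] {P : Matrix ι ι ℝ} (hP : P.PosDef) :
    ∃ c : ℝ, 0 < c ∧ ∀ v : ι → ℝ, c * (v ⬝ᵥ v) ≤ v ⬝ᵥ P *ᵥ v := by
  obtain ⟨C, hC, hle⟩ := exists_quadratic_le P⁻¹
  have hu : IsUnit P.det := (Matrix.isUnit_iff_isUnit_det _).1 hP.isUnit
  refine ⟨C⁻¹, inv_pos.2 hC, fun v => ?_⟩
  have h := hP.quadratic_nonneg (v - C⁻¹ • P⁻¹ *ᵥ v)
  have h2 := hle v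
  have e : P *ᵥ P⁻¹ *ᵥ v = v := by
    rw [Matrix.mulVec_mulVec, Matrix.mul_nonsing_inv _ hu, Matrix.one_mulVec]
  have e2 : (P⁻¹ *ᵥ v) ⬝ᵥ P *ᵥ v = v ⬝ᵥ v := by
    rw [hP.isSymm.dotProduct_mulVec_comm, e]
  simp only [Matrix.mulVec_sub, Matrix.mulVec_smul, sub_dotProduct, dotProduct_sub,
    smul_dotProduct, dotProduct_smul, smul_eq_mul, e, e2] at h
  rw [dotProduct_comm (P⁻¹ *ᵥ v) v] at h
  have : C⁻¹ * (C⁻¹ * (v ⬝ᵥ P⁻¹ *ᵥ v)) ≤ C⁻¹ * (v ⬝ᵥ v) := by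
    refine mul_le_mul_of_nonneg_left ?_ (inv_pos.2 hC).le
    rw [inv_mul_le_iff₀ hC]
    exact h2
  linarith

/-- A scaled Schur complement inequality for quadratic forms, necessity. -/
theorem Matrix.PosDef.schur_nonneg [DecidableEq ι] {P : Matrix ι ι ℝ} (hP : P.PosDef)
    {r : ℝ} (hr : 0 < r) {a : ι → ℝ} {c : ℝ} (h : a ⬝ᵥ P *ᵥ a ≤ r * c) (y : ι → ℝ) :
    0 ≤ r * (y ⬝ᵥ P⁻¹ *ᵥ y) - 2 * (y ⬝ᵥ a) + c := by
  have hu : IsUnit P.det := (Matrix.isUnit_iff_isUnit_det _).1 hP.isUnit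
  have h2 := hP.inv.quadratic_nonneg (r • y - P *ᵥ a)
  have e : P⁻¹ *ᵥ P *ᵥ a = a := by
    rw [Matrix.mulVec_mulVec, Matrix.nonsing_inv_mul _ hu, Matrix.one_mulVec]
  have e2 : (P *ᵥ a) ⬝ᵥ P⁻¹ *ᵥ y = y ⬝ᵥ a := by
    rw [hP.inv.isSymm.dotProduct_mulVec_comm, e]
  simp only [Matrix.mulVec_sub, Matrix.mulVec_smul, sub_dotProduct, dotProduct_sub,
    smul_dotProduct, dotProduct_smul, smul_eq_mul, e, e2] at h2
  rw [dotProduct_comm (P *ᵥ a) a] at h2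
  refine nonneg_of_mul_nonneg_right ?_ hr
  nlinarith

/-- A scaled Schur complement inequality for quadratic forms, sufficiency. -/
theorem Matrix.PosDef.quadratic_le_of_schur [DecidableEq ι] {P : Matrix ι ι ℝ} (hP : P.PosDef)
    {r : ℝ} (hr : 0 < r) {a : ι → ℝ} {c : ℝ}
    (h : ∀ y : ι → ℝ, 0 ≤ r * (y ⬝ᵥ P⁻¹ *ᵥ y) - 2 * (y ⬝ᵥ a) + c) :
    a ⬝ᵥ P *ᵥ a ≤ r * c := by
  have hu : IsUnit P.det := (Matrix.isUnit_iff_isUnit_det _).1 hP.isUnit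
  -- This `y` minimizes the quadratic function in `h`.
  have h2 := h (r⁻¹ • P *ᵥ a)
  have e : P⁻¹ *ᵥ P *ᵥ a = a := by
    rw [Matrix.mulVec_mulVec, Matrix.nonsing_inv_mul _ hu, Matrix.one_mulVec]
  simp only [Matrix.mulVec_smul, smul_dotProduct, dotProduct_smul, smul_eq_mul, e] at h2
  rw [dotProduct_comm (P *ᵥ a) a, mul_inv_cancel_left₀ hr.ne'] at h2
  have : r⁻¹ * (a ⬝ᵥ P *ᵥ a) ≤ c := by linarith
  rwa [inv_mul_le_iff₀ hr] at this

/-- Negative semidefiniteness of a symmetric two-by-two block matrix, as an inequality. -/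
theorem negSemidef_fromBlocks_iff {S : Matrix ι ι ℝ} {N : Matrix ι κ ℝ} {Q : Matrix κ κ ℝ}
    (hS : S.IsSymm) (hQ : Q.IsSymm) :
    NegSemidef (Matrix.fromBlocks (-S) N Nᵀ (-Q)) ↔
      ∀ z w, 0 ≤ z ⬝ᵥ S *ᵥ z - 2 * (z ⬝ᵥ N *ᵥ w) + w ⬝ᵥ Q *ᵥ w := by
  have hval : ∀ z w, (Sum.elim z w) ⬝ᵥ (-Matrix.fromBlocks (-S) N Nᵀ (-Q)) *ᵥ (Sum.elim z w)
      = z ⬝ᵥ S *ᵥ z - 2 * (z ⬝ᵥ N *ᵥ w) + w ⬝ᵥ Q *ᵥ w := by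
    intro z w
    have : w ⬝ᵥ Nᵀ *ᵥ z = z ⬝ᵥ N *ᵥ w := by
      rw [Matrix.mulVec_transpose, dotProduct_comm, Matrix.dotProduct_mulVec]
    rw [Matrix.neg_mulVec, Matrix.fromBlocks_mulVec, dotProduct_neg, sumElim_dotProduct_sumElim]
    simp only [Sum.elim_comp_inl, Sum.elim_comp_inr, Matrix.neg_mulVec, dotProduct_add,
      dotProduct_neg, this]
    ring
  rw [NegSemidef, Matrix.posSemidef_iff_dotProduct_mulVec]
  constructor
  · rintro ⟨-, h⟩ z w
    simpa [hval] using h (Sum.elim z w)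
  · intro h
    refine ⟨?_, fun x => ?_⟩
    · simp [Matrix.IsHermitian, Matrix.conjTranspose_eq_transpose_of_trivial,
        Matrix.fromBlocks_transpose, hS.eq, hQ.eq]
    · have := h (x ∘ Sum.inl) (x ∘ Sum.inr)
      rw [← hval, Sum.elim_comp_inl_inr] at this
      simpa using this

end QuadraticForms

/-! ### Reduction of the sampled-data loop to a discrete-time system. -/

section SampledData

variable {n m : ℕ}

theorem liftedA_mulVec_elim (A : Matrix (Fin n) (Fin n) ℝ) (B : Matrix (Fin n) (Fin m) ℝ)
    (x : Fin n → ℝ) (u : Fin m → ℝ) :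
    liftedA A B *ᵥ Sum.elim x u = Sum.elim (A *ᵥ x + B *ᵥ u) 0 := by
  simp [liftedA, Matrix.fromBlocks_mulVec]

/-- The jump map `(x, v) ↦ (x, K₁ x + K₂ v)` of the closed-loop system at a sampling instant. -/
def jumpMatrix (K₁ : Matrix (Fin m) (Fin n) ℝ) (K₂ : Matrix (Fin m) (Fin m) ℝ) :
    Matrix (Fin n ⊕ Fin m) (Fin n ⊕ Fin m) ℝ :=
  Matrix.fromBlocks 1 0 K₁ K₂

theorem jumpMatrix_mulVec_elim (K₁ : Matrix (Fin m) (Fin n) ℝ) (K₂ : Matrix (Fin m) (Fin m) ℝ)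
    (x : Fin n → ℝ) (u : Fin m → ℝ) :
    jumpMatrix K₁ K₂ *ᵥ Sum.elim x u = Sum.elim x (K₁ *ᵥ x + K₂ *ᵥ u) := by
  simp [jumpMatrix, Matrix.fromBlocks_mulVec]

/-- The held input is not changed by the flow of the lifted system. -/
theorem exp_smul_liftedA_mulVec_inr (A : Matrix (Fin n) (Fin n) ℝ) (B : Matrix (Fin n) (Fin m) ℝ)
    (s : ℝ) (v : Fin n ⊕ Fin m → ℝ) (j : Fin m) :
    (NormedSpace.exp (s • liftedA A B) *ᵥ v) (Sum.inr j) = v (Sum.inr j) := by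
  have h : ∀ r : ℝ, HasDerivAt
      (fun r : ℝ => (NormedSpace.exp (r • liftedA A B) *ᵥ v) (Sum.inr j)) 0 r := fun r => by
    have := hasDerivAt_pi.1 (hasDerivAt_exp_smul_mulVec (liftedA A B) v r) (Sum.inr j)
    rw [← Sum.elim_comp_inl_inr (NormedSpace.exp (r • liftedA A B) *ᵥ v), liftedA_mulVec_elim]
      at this
    exact this
  have := is_const_of_deriv_eq_zero (fun r => (h r).differentiableAt) (fun r => (h r).deriv) s 0
  simpa using this

theorem sampledState_succ {A : Matrix (Fin n) (Fin n) ℝ} {B : Matrix (Fin n) (Fin m) ℝ}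
    {K₁ : Matrix (Fin m) (Fin n) ℝ} {K₂ : Matrix (Fin m) (Fin m) ℝ} {t : ℕ → ℝ}
    {u₀ : Fin m → ℝ} {x : ℝ → Fin n → ℝ} {u : ℝ → Fin m → ℝ} (ht : StrictMono t)
    (h : IsSampledDataTrajectory A B K₁ K₂ t u₀ x u) (k : ℕ) :
    sampledState t u₀ x u (k + 1) = NormedSpace.exp ((t (k + 1) - t k) • liftedA A B) *ᵥ
      jumpMatrix K₁ K₂ *ᵥ sampledState t u₀ x u k := by
  have hlt : t k < t (k + 1) := ht (Nat.lt_succ_self k)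
  have hu : ∀ s ∈ Ico (t k) (t (k + 1)), u s = u (t k) := fun s hs => by
    rw [h.control k s hs, h.control k (t k) (left_mem_Ico.2 hlt)]
  have hy := eq_exp_smul_mulVec_of_hasDerivAt (liftedA A B) hlt
    -- The input component is held at `u (t k)` up to and including `t (k + 1)`, where `u` itself
    -- may jump; the endpoint is then exactly the next sampled state.
    (y := fun s => Sum.elim (x s) (u (t k)))
    (by
      refine continuousOn_pi.2 fun i => ?_
      rcases i with i | i
      · exact (continuous_apply i).comp_continuousOn (h.continuousOn.mono fun s hs =>
          (ht.monotone (Nat.zero_le k)).trans hs.1)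
      · exact continuousOn_const)
    (by
      intro s hs
      rw [liftedA_mulVec_elim, hasDerivAt_pi]
      have hd := h.hasDerivAt k s hs
      rw [hu s (Ioo_subset_Ico_self hs)] at hd
      rintro (i | i)
      · exact hasDerivAt_pi.1 hd i
      · exact hasDerivAt_const _ _)
  have e : Sum.elim (x (t k)) (u (t k)) = jumpMatrix K₁ K₂ *ᵥ sampledState t u₀ x u k := by
    rw [sampledState, jumpMatrix_mulVec_elim, ← h.control k _ (left_mem_Ico.2 hlt)]
  rw [← e, ← hy]
  rfl

theorem isSamplingSequence_mul {Tmin Tmax θ : ℝ} (hθ : θ ∈ Icc Tmin Tmax) (hpos : 0 < θ) :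
    IsSamplingSequence Tmin Tmax (fun k : ℕ => (k : ℝ) * θ) where
  strictMono := fun a b hab => by
    have : (a : ℝ) < b := by exact_mod_cast hab
    simpa using mul_lt_mul_of_pos_right this hpos
  tendsto_atTop := tendsto_natCast_atTop_atTop.atTop_mul_const hpos
  dwell := fun k => by
    have : ((k + 1 : ℕ) : ℝ) * θ - k * θ = θ := by push_cast; ring
    rw [this]
    exact hθ

/-- Periodic sampling: a closed-loop trajectory exists for all initial data. -/
theorem exists_trajectory_of_periodic (A : Matrix (Fin n) (Fin n) ℝ) (B : Matrix (Fin n) (Fin m) ℝ)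
    (K₁ : Matrix (Fin m) (Fin n) ℝ) (K₂ : Matrix (Fin m) (Fin m) ℝ) {θ : ℝ} (hθ : 0 < θ)
    (v : Fin n ⊕ Fin m → ℝ) :
    ∃ (u₀ : Fin m → ℝ) (x : ℝ → Fin n → ℝ) (u : ℝ → Fin m → ℝ),
      IsSampledDataTrajectory A B K₁ K₂ (fun k : ℕ => (k : ℝ) * θ) u₀ x u ∧
      sampledState (fun k : ℕ => (k : ℝ) * θ) u₀ x u 0 = v := by
  let F := liftedA A B
  let M := jumpMatrix K₁ K₂
  let ξ : ℕ → Fin n ⊕ Fin m → ℝ := fun k => Nat.rec v (fun _ w => NormedSpace.exp (θ • F) *ᵥ M *ᵥ w) k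
  have hξ : ∀ k, ξ (k + 1) = NormedSpace.exp (θ • F) *ᵥ M *ᵥ ξ k := fun k => rfl
  let X : ℕ → ℝ → Fin n ⊕ Fin m → ℝ := fun k s => NormedSpace.exp ((s - k * θ) • F) *ᵥ M *ᵥ ξ k
  let x : ℝ → Fin n → ℝ := fun s => X ⌊s / θ⌋₊ s ∘ Sum.inl
  let u : ℝ → Fin m → ℝ := fun s => (M *ᵥ ξ ⌊s / θ⌋₊) ∘ Sum.inr
  have hM : ∀ w : Fin n ⊕ Fin m → ℝ,
      M *ᵥ w = Sum.elim (w ∘ Sum.inl) (K₁ *ᵥ (w ∘ Sum.inl) + K₂ *ᵥ (w ∘ Sum.inr)) := fun w => by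
    conv_lhs => rw [← Sum.elim_comp_inl_inr w]
    exact jumpMatrix_mulVec_elim _ _ _ _
  have hfloor : ∀ (k : ℕ), ∀ s ∈ Ico ((k : ℝ) * θ) ((k + 1 : ℕ) * θ), ⌊s / θ⌋₊ = k := by
    intro k s hs
    rw [Nat.floor_eq_iff (div_nonneg ((by positivity : (0 : ℝ) ≤ k * θ).trans hs.1) hθ.le),
      le_div_iff₀ hθ, div_lt_iff₀ hθ]
    exact_mod_cast hs
  have hmem : ∀ k : ℕ, (k : ℝ) * θ ∈ Ico ((k : ℝ) * θ) ((k + 1 : ℕ) * θ) := fun k =>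
    left_mem_Ico.2 ((isSamplingSequence_mul (left_mem_Icc.2 le_rfl) hθ).strictMono
      (Nat.lt_succ_self k))
  have hXd : ∀ k s, HasDerivAt (X k) (F *ᵥ X k s) s := fun k s => by
    have h := (hasDerivAt_exp_smul_mulVec F (M *ᵥ ξ k) (s - k * θ)).scomp s
      ((hasDerivAt_id s).sub_const (k * θ))
    rwa [one_smul] at h
  have hXr : ∀ k s, X k s ∘ Sum.inr = (M *ᵥ ξ k) ∘ Sum.inr := fun k s => by
    funext j
    exact exp_smul_liftedA_mulVec_inr A B _ _ j
  have hxt : ∀ k : ℕ, x (k * θ) = ξ k ∘ Sum.inl := fun k => by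
    simp only [x, X]
    rw [hfloor k _ (hmem k), sub_self, zero_smul, NormedSpace.exp_zero, Matrix.one_mulVec, hM]
    rfl
  have hprev : ∀ k : ℕ, prevInput (fun k : ℕ => (k : ℝ) * θ) (v ∘ Sum.inr) u k = ξ k ∘ Sum.inr := by
    rintro (_ | k)
    · rfl
    · have : u (k * θ) = (M *ᵥ ξ k) ∘ Sum.inr := by
        simp only [u]
        rw [hfloor k _ (hmem k)]
      refine this.trans ?_
      funext j
      exact (exp_smul_liftedA_mulVec_inr A B θ _ j).symm
  -- At the right endpoint the floor already equals `k + 1`; the two pieces agree there because the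
  -- jump leaves the `x` component unchanged.
  have hxeq : ∀ k : ℕ, EqOn x (fun s => X k s ∘ Sum.inl) (Icc ((k : ℝ) * θ) ((k + 1 : ℕ) * θ)) := by
    intro k s hs
    rcases hs.2.lt_or_eq with h | h
    · simp only [x]
      rw [hfloor k s ⟨hs.1, h⟩]
    · subst h
      have e : ((k + 1 : ℕ) : ℝ) * θ - k * θ = θ := by push_cast; ring
      simp only [hxt, hξ, X, e]
  have hcont : ∀ k : ℕ, ContinuousOn x (Icc 0 (k * θ)) := by
    intro k
    induction k with
    | zero => simp
    | succ k ih =>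
      rw [← Icc_union_Icc_eq_Icc (by positivity : (0 : ℝ) ≤ k * θ) (hmem k).2.le]
      refine ih.union_of_isClosed ?_ isClosed_Icc isClosed_Icc
      refine ContinuousOn.congr ?_ (hxeq k)
      refine continuousOn_pi.2 fun i s _ => ?_
      exact (hasDerivAt_pi.1 (hXd k s) (Sum.inl i)).continuousAt.continuousWithinAt
  refine ⟨v ∘ Sum.inr, x, u, ⟨?_, ?_, ?_⟩, ?_⟩
  · intro s hs
    simp only [Nat.cast_zero, zero_mul] at hs ⊢
    obtain ⟨k, hk⟩ := exists_nat_gt (s / θ)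
    rw [div_lt_iff₀ hθ] at hk
    refine (hcont k s ⟨hs, hk.le⟩).mono_of_mem_nhdsWithin ?_
    rw [← Ici_inter_Iic]
    exact inter_mem_nhdsWithin _ (Iic_mem_nhds hk)
  · intro k s hs
    have hx : x =ᶠ[nhds s] fun s => X k s ∘ Sum.inl := by
      filter_upwards [Ioo_mem_nhds hs.1 hs.2] with r hr using hxeq k (Ioo_subset_Icc_self hr)
    have hus : u s = X k s ∘ Sum.inr := by
      rw [hXr]
      simp only [u]
      rw [hfloor k s (Ioo_subset_Ico_self hs)]
    refine HasDerivAt.congr_of_eventuallyEq ?_ hx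
    rw [hx.eq_of_nhds, hus, hasDerivAt_pi]
    intro i
    have := hasDerivAt_pi.1 (hXd k s) (Sum.inl i)
    rw [← Sum.elim_comp_inl_inr (X k s), liftedA_mulVec_elim] at this
    exact this
  · intro k s hs
    rw [hprev, hxt]
    simp only [u]
    rw [hfloor k s hs, hM]
    rfl
  · rw [sampledState, hprev]
    have := hxt 0
    rw [this]
    exact Sum.elim_comp_inl_inr v

/-- Quadratic stability of the sampled-data system is quadratic stability of the discrete-time
system `ξ ↦ exp (θ [A B; 0 0]) [I 0; K₁ K₂] ξ`, uniformly in `θ`. -/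
theorem quadraticallyStabilizes_iff (A : Matrix (Fin n) (Fin n) ℝ) (B : Matrix (Fin n) (Fin m) ℝ)
    (K₁ : Matrix (Fin m) (Fin n) ℝ) (K₂ : Matrix (Fin m) (Fin m) ℝ) {Tmin Tmax : ℝ}
    (hTmin : 0 ≤ Tmin) (hTmax : 0 < Tmax) :
    QuadraticallyStabilizes A B K₁ K₂ Tmin Tmax ↔
      ∃ P : Matrix (Fin n ⊕ Fin m) (Fin n ⊕ Fin m) ℝ, P.PosDef ∧ ∃ α : ℝ, 0 < α ∧
        ∀ θ ∈ Icc Tmin Tmax, ∀ v : Fin n ⊕ Fin m → ℝ,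
          (NormedSpace.exp (θ • liftedA A B) *ᵥ jumpMatrix K₁ K₂ *ᵥ v) ⬝ᵥ
            P *ᵥ (NormedSpace.exp (θ • liftedA A B) *ᵥ jumpMatrix K₁ K₂ *ᵥ v) - v ⬝ᵥ P *ᵥ v
          ≤ -α * (v ⬝ᵥ v) := by
  refine exists_congr fun P => and_congr_right fun hP => exists_congr fun α =>
    and_congr_right fun hα => ⟨fun h => ?_, fun h => ?_⟩
  · have hpos : ∀ θ ∈ Ioc 0 Tmax, Tmin ≤ θ → ∀ v : Fin n ⊕ Fin m → ℝ,
        (NormedSpace.exp (θ • liftedA A B) *ᵥ jumpMatrix K₁ K₂ *ᵥ v) ⬝ᵥ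
          P *ᵥ (NormedSpace.exp (θ • liftedA A B) *ᵥ jumpMatrix K₁ K₂ *ᵥ v) - v ⬝ᵥ P *ᵥ v
          ≤ -α * (v ⬝ᵥ v) := by
      intro θ hθ hle v
      obtain ⟨u₀, x, u, htr, h0⟩ := exists_trajectory_of_periodic A B K₁ K₂ hθ.1 v
      have hs := isSamplingSequence_mul (Tmin := Tmin) ⟨hle, hθ.2⟩ hθ.1
      have := h _ u₀ x u hs htr 0
      rw [sampledState_succ hs.strictMono htr, h0] at this
      simpa using this
    intro θ hθ v
    rcases (hTmin.trans hθ.1).lt_or_eq with h0 | h0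
    · exact hpos θ ⟨h0, hθ.2⟩ hθ.1 v
    · subst h0
      -- A zero sampling interval is never realized by strictly increasing instants, so this case is
      -- the limit `r → 0⁺`; such small `r` are admissible because here `Tmin ≤ 0`.
      have hc : ∀ i, Continuous fun r : ℝ =>
          (NormedSpace.exp (r • liftedA A B) *ᵥ jumpMatrix K₁ K₂ *ᵥ v) i := fun i =>
        continuous_iff_continuousAt.2 fun r =>
          (hasDerivAt_pi.1 (hasDerivAt_exp_smul_mulVec (liftedA A B) _ r) i).continuousAt
      have hc' := continuous_pi hc
      have hq : Continuous fun r : ℝ =>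
          (NormedSpace.exp (r • liftedA A B) *ᵥ jumpMatrix K₁ K₂ *ᵥ v) ⬝ᵥ
            P *ᵥ (NormedSpace.exp (r • liftedA A B) *ᵥ jumpMatrix K₁ K₂ *ᵥ v) - v ⬝ᵥ P *ᵥ v :=
        (hc'.dotProduct (continuous_const.matrix_mulVec hc')).sub continuous_const
      refine le_of_tendsto (hq.continuousWithinAt (s := Ioi 0) (x := 0)).tendsto ?_
      filter_upwards [Ioc_mem_nhdsGT hTmax] with r hr using hpos r hr (hθ.1.trans hr.1.le) v
  · intro t u₀ x u hs htr k
    rw [sampledState_succ hs.strictMono htr]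
    exact h _ (hs.dwell k) _

end SampledData

/-! ### Equivalence with the matrix inequalities. -/

section Feasibility

variable {n m : ℕ}

/-- The substitution `Y = K Q`, used in both directions to pass between gains and the linear
unknown. -/
theorem matJ₀_mul_add_matB₀_mul (K₁ : Matrix (Fin m) (Fin n) ℝ) (K₂ : Matrix (Fin m) (Fin m) ℝ)
    (Q : Matrix (Fin n ⊕ Fin m) (Fin n ⊕ Fin m) ℝ) :
    matJ₀ n m * Q + matB₀ n m * (Matrix.fromCols K₁ K₂ * Q) = jumpMatrix K₁ K₂ * Q := by
  have : matJ₀ n m + matB₀ n m * Matrix.fromCols K₁ K₂ = jumpMatrix K₁ K₂ := by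
    rw [matJ₀, matB₀, jumpMatrix, Matrix.fromRows_mul_fromCols, Matrix.fromBlocks_add]
    simp
  rw [← this, Matrix.add_mul, Matrix.mul_assoc]

theorem exp_smul_transpose_mulVec_dotProduct {ι : Type*} [Fintype ι] [DecidableEq ι]
    (F : Matrix ι ι ℝ) (θ : ℝ) (y v : ι → ℝ) :
    (NormedSpace.exp (θ • Fᵀ) *ᵥ y) ⬝ᵥ v = y ⬝ᵥ NormedSpace.exp (θ • F) *ᵥ v := by
  rw [← exp_smul_transpose, Matrix.mulVec_transpose, ← Matrix.dotProduct_mulVec]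

theorem exists_isFeasible_of_quadraticallyStabilizes (A : Matrix (Fin n) (Fin n) ℝ)
    (B : Matrix (Fin n) (Fin m) ℝ) (K₁ : Matrix (Fin m) (Fin n) ℝ) (K₂ : Matrix (Fin m) (Fin m) ℝ)
    {Tmin Tmax : ℝ} (hTmin : 0 ≤ Tmin) (hTmax : 0 < Tmax)
    (h : QuadraticallyStabilizes A B K₁ K₂ Tmin Tmax) :
    ∃ (S : ℝ → Matrix (Fin n ⊕ Fin m) (Fin n ⊕ Fin m) ℝ)
      (Y : Matrix (Fin m) (Fin n ⊕ Fin m) ℝ) (ε : ℝ), IsFeasible A B Tmin Tmax S Y ε := by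
  obtain ⟨P, hP, α, hα, hdec⟩ := (quadraticallyStabilizes_iff A B K₁ K₂ hTmin hTmax).1 h
  obtain ⟨CP, hCP, hPle⟩ := exists_quadratic_le P
  obtain ⟨q, hq, hQle⟩ := hP.inv.exists_le_quadratic
  let F := liftedA A B
  obtain ⟨C, hC, hexp⟩ := exists_exp_smul_mulVec_le Fᵀ Tmin Tmax
  have hu : IsUnit P.det := (Matrix.isUnit_iff_isUnit_det _).1 hP.isUnit
  -- Chosen so that `δ v·Pv ≤ α |v|²`, turning the decrease into contraction by `1 - δ`; the bound
  -- `1 / 2` keeps this factor positive for the Schur step.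
  set δ := min (1 / 2) (α / CP) with hδ
  have hδ0 : 0 < δ := by positivity
  have hδ1 : δ ≤ 1 / 2 := min_le_left _ _
  have hδα : δ * CP ≤ α := (le_div_iff₀ hCP).1 (min_le_right _ _)
  let Q := P⁻¹
  let S : ℝ → Matrix (Fin n ⊕ Fin m) (Fin n ⊕ Fin m) ℝ := fun τ =>
    NormedSpace.exp (τ • (-F)) * Q * NormedSpace.exp (τ • (-Fᵀ))
  have hS0 : S 0 = Q := by simp [S]
  have hSsymm : ∀ τ, (S τ).IsSymm := fun τ => by
    have e : NormedSpace.exp (τ • (-Fᵀ)) = (NormedSpace.exp (τ • (-F)))ᵀ := by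
      rw [exp_smul_transpose, Matrix.transpose_neg]
    simp only [S, e, Matrix.IsSymm, Matrix.transpose_mul, Matrix.transpose_transpose,
      hP.inv.isSymm.eq, Q, Matrix.mul_assoc]
  have hSd : ∀ τ i j, HasDerivWithinAt (fun r => S r i j) ((-(F * S τ + S τ * Fᵀ)) i j)
      (Icc 0 Tmax) τ := by
    intro τ i j
    have h1 := hasDerivWithinAt_mul_entry (t := Icc 0 Tmax) (s := τ)
      (X := fun r => NormedSpace.exp (r • (-F))) (Y := fun _ => Q) (Y' := 0)
      (fun i j => (hasDerivAt_exp_smul_entry (-F) τ i j).hasDerivWithinAt)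
      (fun i j => hasDerivWithinAt_const _ _ _)
    have h2 := hasDerivWithinAt_mul_entry h1
      (fun i j => (hasDerivAt_exp_smul_entry (-Fᵀ) τ i j).hasDerivWithinAt) i j
    convert h2 using 2
    rw [(exp_smul_commute (-Fᵀ) τ).eq]
    simp only [S, Matrix.mul_zero, add_zero, Matrix.mul_assoc, Matrix.neg_mul, Matrix.mul_neg,
      neg_add]
  -- With `z = exp (θ Fᵀ) y`, this `ε` gives `ε |z|² ≤ δ q |y|² ≤ δ y·Qy`, the slack left by the
  -- contraction.
  refine ⟨S, Matrix.fromCols K₁ K₂ * Q, δ * q / C, fun τ _ => hSsymm τ,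
    fun i j τ _ => (hSd τ i j).differentiableWithinAt, ?_, by positivity, ?_, ?_⟩
  · rw [hS0]
    exact hP.inv
  · intro τ hτ
    have : matrixDerivOn Tmax S τ = -(F * S τ + S τ * Fᵀ) := by
      ext i j
      exact (hSd τ i j).derivWithin (uniqueDiffOn_Icc hTmax τ hτ)
    rw [this, NegSemidef, add_neg_cancel, neg_zero]
    exact Matrix.PosSemidef.zero
  · intro θ hθ
    rw [hS0, matJ₀_mul_add_matB₀_mul,
      show ∀ R : Matrix (Fin n ⊕ Fin m) (Fin n ⊕ Fin m) ℝ, -S θ + R = -(S θ - R) from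
        fun R => by abel,
      negSemidef_fromBlocks_iff ((hSsymm θ).sub (by simp [Matrix.IsSymm])) hP.inv.isSymm]
    intro z w
    -- In the variables `v`, `y` the block form without its `ε` term is `y·Qy - 2 y·exp(θF)Mv +
    -- v·Pv`.
    set v := Q *ᵥ w with hv
    set y := NormedSpace.exp (-θ • Fᵀ) *ᵥ z with hy
    have hz : z = NormedSpace.exp (θ • Fᵀ) *ᵥ y := by
      rw [hy, Matrix.mulVec_mulVec, exp_smul_mul_exp_neg_smul, Matrix.one_mulVec]
    have hzS : z ⬝ᵥ S θ *ᵥ z = y ⬝ᵥ Q *ᵥ y := by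
      simp only [S, smul_neg, ← neg_smul]
      rw [← Matrix.mulVec_mulVec, ← hy, ← Matrix.mulVec_mulVec,
        ← exp_smul_transpose_mulVec_dotProduct, ← hy]
    have hzN : z ⬝ᵥ (jumpMatrix K₁ K₂ * Q) *ᵥ w
        = y ⬝ᵥ NormedSpace.exp (θ • F) *ᵥ jumpMatrix K₁ K₂ *ᵥ v := by
      rw [← Matrix.mulVec_mulVec, ← exp_smul_transpose_mulVec_dotProduct, ← hz]
    have hwQ : w ⬝ᵥ Q *ᵥ w = v ⬝ᵥ P *ᵥ v := by
      rw [hv, Matrix.mulVec_mulVec (v := w) (M := P), Matrix.mul_nonsing_inv _ hu,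
        Matrix.one_mulVec, dotProduct_comm]
    have hzz : z ⬝ᵥ z ≤ C * (y ⬝ᵥ y) := by
      rw [hz]
      exact hexp θ hθ y
    have hd : (NormedSpace.exp (θ • F) *ᵥ jumpMatrix K₁ K₂ *ᵥ v) ⬝ᵥ
        P *ᵥ (NormedSpace.exp (θ • F) *ᵥ jumpMatrix K₁ K₂ *ᵥ v) ≤ (1 - δ) * (v ⬝ᵥ P *ᵥ v) := by
      have h1 := hdec θ hθ v
      have h2 : δ * (v ⬝ᵥ P *ᵥ v) ≤ α * (v ⬝ᵥ v) := by
        refine (mul_le_mul_of_nonneg_left (hPle v) hδ0.le).trans ?_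
        rw [← mul_assoc]
        exact mul_le_mul_of_nonneg_right hδα (dotProduct_self_nonneg_real v)
      linarith
    have hsch := hP.schur_nonneg (by linarith) hd y
    have hε : δ * q / C * (z ⬝ᵥ z) ≤ δ * (y ⬝ᵥ Q *ᵥ y) := by
      calc δ * q / C * (z ⬝ᵥ z) ≤ δ * q / C * (C * (y ⬝ᵥ y)) := by gcongr
        _ = δ * (q * (y ⬝ᵥ y)) := by field_simp
        _ ≤ δ * (y ⬝ᵥ Q *ᵥ y) := by gcongr; exact hQle y
    rw [Matrix.sub_mulVec, Matrix.smul_mulVec, Matrix.one_mulVec, dotProduct_sub,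
      dotProduct_smul, smul_eq_mul, hzS, hzN, hwQ]
    linarith

/-- Along the adjoint flow, a solution of the Lyapunov differential inequality decreases. -/
theorem IsFeasible.antitoneOn_quadratic {A : Matrix (Fin n) (Fin n) ℝ}
    {B : Matrix (Fin n) (Fin m) ℝ} {Tmin Tmax : ℝ}
    {S : ℝ → Matrix (Fin n ⊕ Fin m) (Fin n ⊕ Fin m) ℝ} {Y : Matrix (Fin m) (Fin n ⊕ Fin m) ℝ}
    {ε : ℝ} (h : IsFeasible A B Tmin Tmax S Y ε) (y : Fin n ⊕ Fin m → ℝ) :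
    AntitoneOn (fun τ : ℝ => (NormedSpace.exp (τ • (liftedA A B)ᵀ) *ᵥ y) ⬝ᵥ
      S τ *ᵥ (NormedSpace.exp (τ • (liftedA A B)ᵀ) *ᵥ y)) (Icc 0 Tmax) := by
  let F := liftedA A B
  let p : ℝ → Fin n ⊕ Fin m → ℝ := fun τ => NormedSpace.exp (τ • Fᵀ) *ᵥ y
  have hp : ∀ τ i, HasDerivWithinAt (fun r => p r i) ((Fᵀ *ᵥ p τ) i) (Icc 0 Tmax) τ := fun τ i =>
    (hasDerivAt_pi.1 (hasDerivAt_exp_smul_mulVec Fᵀ y τ) i).hasDerivWithinAt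
  have hd : ∀ τ ∈ Icc 0 Tmax, HasDerivWithinAt (fun r => p r ⬝ᵥ S r *ᵥ p r)
      (p τ ⬝ᵥ (F * S τ + S τ * Fᵀ + matrixDerivOn Tmax S τ) *ᵥ p τ) (Icc 0 Tmax) τ := by
    intro τ hτ
    have hS : ∀ i j, HasDerivWithinAt (fun r => S r i j) (matrixDerivOn Tmax S τ i j)
        (Icc 0 Tmax) τ := fun i j => (h.differentiable i j τ hτ).hasDerivWithinAt
    -- The product rule reproduces the left side of the Lyapunov inequality, evaluated at `p τ`.
    have := hasDerivWithinAt_dotProduct (hp τ) (hasDerivWithinAt_mulVec hS (hp τ))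
    convert this using 1
    have e : (Fᵀ *ᵥ p τ) ⬝ᵥ S τ *ᵥ p τ = p τ ⬝ᵥ (F * S τ) *ᵥ p τ := by
      rw [Matrix.mulVec_transpose, ← Matrix.dotProduct_mulVec, Matrix.mulVec_mulVec]
    rw [e]
    simp only [Matrix.add_mulVec, dotProduct_add, Matrix.mulVec_mulVec]
    ring
  refine antitoneOn_of_hasDerivWithinAt_nonpos (convex_Icc _ _)
    (fun τ hτ => (hd τ hτ).continuousWithinAt)
    (fun τ hτ => (hd τ (interior_subset hτ)).mono interior_subset) fun τ hτ => ?_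
  have := (h.differential τ (interior_subset hτ)).dotProduct_mulVec_nonneg (p τ)
  rw [Matrix.neg_mulVec, dotProduct_neg] at this
  simpa using this

theorem IsFeasible.quadraticallyStabilizes {A : Matrix (Fin n) (Fin n) ℝ}
    {B : Matrix (Fin n) (Fin m) ℝ} {Tmin Tmax : ℝ}
    {S : ℝ → Matrix (Fin n ⊕ Fin m) (Fin n ⊕ Fin m) ℝ} {Y : Matrix (Fin m) (Fin n ⊕ Fin m) ℝ}
    {ε : ℝ} (hTmin : 0 ≤ Tmin) (hTmax : 0 < Tmax) (h : IsFeasible A B Tmin Tmax S Y ε) :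
    QuadraticallyStabilizes A B (Y * (S 0)⁻¹).toCols₁ (Y * (S 0)⁻¹).toCols₂ Tmin Tmax := by
  rw [quadraticallyStabilizes_iff A B _ _ hTmin hTmax]
  let F := liftedA A B
  have hQ := h.posDef_zero
  have hu : IsUnit (S 0).det := (Matrix.isUnit_iff_isUnit_det _).1 hQ.isUnit
  obtain ⟨CQ, hCQ, hQle⟩ := exists_quadratic_le (S 0)
  obtain ⟨c, hc, hPge⟩ := hQ.inv.exists_le_quadratic
  -- Negative times, since `y` has to be bounded by `z = exp (θ Fᵀ) y`.
  obtain ⟨C, hC, hexp⟩ := exists_exp_smul_mulVec_le Fᵀ (-Tmax) (-Tmin)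
  set M := jumpMatrix (Y * (S 0)⁻¹).toCols₁ (Y * (S 0)⁻¹).toCols₂ with hM
  have hN : matJ₀ n m * S 0 + matB₀ n m * Y = M * S 0 := by
    rw [hM, ← matJ₀_mul_add_matB₀_mul, Matrix.fromCols_toCols, Matrix.mul_assoc Y,
      Matrix.nonsing_inv_mul _ hu, Matrix.mul_one]
  have hε := h.eps_pos
  -- Chosen so that `δ y·S(0)y ≤ δ CQ C |z|² ≤ ε |z|²`.
  set δ := min (1 / 2) (ε / (C * CQ)) with hδ
  have hδ0 : 0 < δ := by positivity
  have hδ1 : δ ≤ 1 / 2 := min_le_left _ _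
  have hδε : δ * (C * CQ) ≤ ε := (le_div_iff₀ (by positivity)).1 (min_le_right _ _)
  refine ⟨(S 0)⁻¹, hQ.inv, δ * c, by positivity, fun θ hθ v => ?_⟩
  have hθ' : θ ∈ Icc 0 Tmax := ⟨hTmin.trans hθ.1, hθ.2⟩
  have hblock := h.block θ hθ
  rw [hN, show ∀ R : Matrix (Fin n ⊕ Fin m) (Fin n ⊕ Fin m) ℝ, -S θ + R = -(S θ - R) from
      fun R => by abel,
    negSemidef_fromBlocks_iff ((h.symm θ hθ').sub (by simp [Matrix.IsSymm])) hQ.isSymm] at hblock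
  have hle : (NormedSpace.exp (θ • F) *ᵥ M *ᵥ v) ⬝ᵥ
      (S 0)⁻¹ *ᵥ (NormedSpace.exp (θ • F) *ᵥ M *ᵥ v) ≤ (1 - δ) * (v ⬝ᵥ (S 0)⁻¹ *ᵥ v) := by
    refine hQ.inv.quadratic_le_of_schur (by linarith) fun y => ?_
    rw [Matrix.nonsing_inv_nonsing_inv _ hu]
    set z := NormedSpace.exp (θ • Fᵀ) *ᵥ y with hz
    have hb := hblock z ((S 0)⁻¹ *ᵥ v)
    have hy : y = NormedSpace.exp (-θ • Fᵀ) *ᵥ z := by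
      rw [hz, Matrix.mulVec_mulVec, exp_neg_smul_mul_exp_smul, Matrix.one_mulVec]
    have hyy : y ⬝ᵥ y ≤ C * (z ⬝ᵥ z) := by
      conv_lhs => rw [hy]
      exact hexp (-θ) ⟨neg_le_neg hθ.2, neg_le_neg hθ.1⟩ z
    -- Monotonicity from `0` to `θ` gives `z·S(θ)z ≤ y·S(0)y`, so `S(θ)` in the block inequality can
    -- be replaced by `S(0)`.
    have hanti := h.antitoneOn_quadratic y (left_mem_Icc.2 hTmax.le) hθ' hθ'.1
    simp only [zero_smul, NormedSpace.exp_zero, Matrix.one_mulVec] at hanti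
    change z ⬝ᵥ S θ *ᵥ z ≤ _ at hanti
    have e : S 0 *ᵥ (S 0)⁻¹ *ᵥ v = v := by
      rw [Matrix.mulVec_mulVec, Matrix.mul_nonsing_inv _ hu, Matrix.one_mulVec]
    rw [← Matrix.mulVec_mulVec, e, dotProduct_comm ((S 0)⁻¹ *ᵥ v) v, hz,
      exp_smul_transpose_mulVec_dotProduct (v := M *ᵥ v), ← hz, Matrix.sub_mulVec,
      Matrix.smul_mulVec, Matrix.one_mulVec, dotProduct_sub, dotProduct_smul, smul_eq_mul] at hb
    have hδy : δ * (y ⬝ᵥ S 0 *ᵥ y) ≤ ε * (z ⬝ᵥ z) := by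
      calc δ * (y ⬝ᵥ S 0 *ᵥ y) ≤ δ * (CQ * (C * (z ⬝ᵥ z))) := by
            gcongr
            exact (hQle y).trans (by gcongr)
        _ = δ * (C * CQ) * (z ⬝ᵥ z) := by ring
        _ ≤ ε * (z ⬝ᵥ z) := mul_le_mul_of_nonneg_right hδε (dotProduct_self_nonneg_real z)
    linarith
  have := mul_le_mul_of_nonneg_left (hPge v) hδ0.le
  linarith

end Feasibility

theorem theorem7 {n m : ℕ} (A : Matrix (Fin n) (Fin n) ℝ) (B : Matrix (Fin n) (Fin m) ℝ)
    (Tmin Tmax : ℝ) (hTmin : 0 ≤ Tmin) (hT : Tmin ≤ Tmax) (hTmax : 0 < Tmax) :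
    ((∃ (K₁ : Matrix (Fin m) (Fin n) ℝ) (K₂ : Matrix (Fin m) (Fin m) ℝ),
        QuadraticallyStabilizes A B K₁ K₂ Tmin Tmax) ↔
      ∃ (S : ℝ → Matrix (Fin n ⊕ Fin m) (Fin n ⊕ Fin m) ℝ)
        (Y : Matrix (Fin m) (Fin n ⊕ Fin m) ℝ) (ε : ℝ), IsFeasible A B Tmin Tmax S Y ε) ∧
    ∀ (S : ℝ → Matrix (Fin n ⊕ Fin m) (Fin n ⊕ Fin m) ℝ)
      (Y : Matrix (Fin m) (Fin n ⊕ Fin m) ℝ) (ε : ℝ), IsFeasible A B Tmin Tmax S Y ε →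
        QuadraticallyStabilizes A B (Y * (S 0)⁻¹).toCols₁ (Y * (S 0)⁻¹).toCols₂ Tmin Tmax := by
  have hmain := fun S Y ε (h : IsFeasible A B Tmin Tmax S Y ε) =>
    h.quadraticallyStabilizes hTmin hTmax
  refine ⟨⟨?_, ?_⟩, hmain⟩
  · rintro ⟨K₁, K₂, h⟩
    exact exists_isFeasible_of_quadraticallyStabilizes A B K₁ K₂ hTmin hTmax h
  · rintro ⟨S, Y, ε, h⟩
    exact ⟨_, _, hmain S Y ε h⟩
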